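/- Let $\mathsf k$ be a field, let $G$ be a simple graph and let $I=I(G)=(vw : \{v,w\}\in E(G))$ be its edge ideal in the polynomial ring over $\mathsf k$ whose variables are the vertices of $G$. For a monomial ideal $J$, the Taylor complex of $J$ is the full simplex on the minimal monomial generators of $J$, each face being labelled by the least common multiple of its vertices; the Scarf complex $\mathrm{Scarf}(J)$ is the subcomplex of all faces whose label is not the label of any other face of the Taylor complex. $J$ has a Scarf resolution if $\mathrm{Scarf}(J)$ supports a free resolution of $J$, i.e. if the simplicial chain complex of $\mathrm{Scarf}(J)$, homogenized by the labels, is a free resolution of $J$. Graphs are regarded below as simplicial complexes of dimension at most $1$ (in particular no square is filled in). Let $t$ be a natural number. 1. If $t\ge 1$ and $G$ is a triangle, then $\mathrm{Scarf}(I^t)$ consists of $\binom{t+2}{2}$ isolated vertices. 2. If $t\ge 2$ and $G$ is a path of length $3$ with edges $ab, bc, cd$, then $\mathrm{Scarf}(I^t)$ is the upper triangular portion of a $t\times t$ grid of squares: its vertices are the distinct monomials $m_{r,s}=a^{t-s}b^{t-r}c^{s}d^{r}$ with $0\le r\le s\le t$, its edges are the pairs $\{m_{r,s},m_{r',s'}\}$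 with $|r-r'|+|s-s'|=1$, and it has no other faces. 3. If $t\ge 2$ and $G$ is a claw with edges $ab, ac, ad$, then $\mathrm{Scarf}(I^t)$ is the disjoint union of a cycle of length $3t$ and $\binom{t+2}{2}-3t$ isolated vertices, the successive vertices of the cycle being $a^tb^t, a^tb^{t-1}c,\dots,a^tc^t, a^tc^{t-1}d,\dots,a^td^t,a^tbd^{t-1},\dots,a^tb^{t-1}d$. 4. If $t\ge 1$ and $G$ is a square with edges $ab, bc, cd, da$, then $\mathrm{Scarf}(I^t)$ is a $t\times t$ grid of squares: its vertices are the distinct monomials $m_{r,s}=a^{t-s}b^{t-r}c^{s}d^{r}$ with $0\le r,s\le t$, its edges are the pairs $\{m_{r,s},m_{r',s'}\}$ with $|r-r'|+|s-s'|=1$, and it has no other faces. In particular, in each of these cases $I^t$ does not have a Scarf resolution. -/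

import Mathlib

noncomputable section

open MvPolynomial SimpleGraph

/-- The edge ideal `I(G) = (x_v x_w : v w an edge of G)` in the polynomial ring over `k` whose
variables are the vertices of `G`. -/
def edgeIdeal (k : Type*) [Field k] {V : Type*} (G : SimpleGraph V) : Ideal (MvPolynomial V k) :=
  Ideal.span {f | ∃ v w, G.Adj v w ∧ f = X v * X w}

/-- The minimal monomial generators of a monomial ideal `I`, given by their exponent vectors: the
monomials in `I` that are minimal with respect to divisibility. -/
def minGens {k : Type*} [Field k] {V : Type*} (I : Ideal (MvPolynomial V k)) : Set (V →₀ ℕ) :=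
  {m | Minimal (fun u : V →₀ ℕ => monomial u (1 : k) ∈ I) m}

/-- The label of a finite set of monomials (exponent vectors): their least common multiple. -/
def lcmLabel {V : Type*} (τ : Finset (V →₀ ℕ)) : V →₀ ℕ := τ.sup id

/-- The Taylor complex of `I`: the full simplex on the minimal monomial generators. -/
def taylorComplex {k : Type*} [Field k] {V : Type*} (I : Ideal (MvPolynomial V k)) :
    PreAbstractSimplicialComplex (V →₀ ℕ) where
  faces := {τ | τ.Nonempty ∧ (τ : Set (V →₀ ℕ)) ⊆ minGens I}
  isRelLowerSet_faces := fun _ h =>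
    ⟨h.1, fun _ hs hn => ⟨hn, fun _ hx => h.2 (hs hx)⟩⟩

theorem lcmLabel_union {V : Type*} [DecidableEq (V →₀ ℕ)] (σ τ : Finset (V →₀ ℕ)) :
    lcmLabel (σ ∪ τ) = lcmLabel σ ⊔ lcmLabel τ := Finset.sup_union

/-- The Scarf complex of `I`: the subcomplex of the Taylor complex consisting of the faces whose
label is not the label of any other face of the Taylor complex. -/
def scarfComplex {k : Type*} [Field k] {V : Type*} (I : Ideal (MvPolynomial V k)) :
    PreAbstractSimplicialComplex (V →₀ ℕ) where
  faces := {τ | τ ∈ (taylorComplex I).faces ∧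
    ∀ ρ ∈ (taylorComplex I).faces, lcmLabel ρ = lcmLabel τ → ρ = τ}
  isRelLowerSet_faces := by
    classical
    rintro σ ⟨hσ, hu⟩
    refine ⟨hσ.1, fun τ hτσ hτ => ⟨(taylorComplex I).isRelLowerSet_faces hσ |>.2 hτσ hτ, ?_⟩⟩
    intro ρ hρ hl
    have hsplit : τ ∪ (σ \ τ) = σ := Finset.union_sdiff_of_subset hτσ
    have hle : lcmLabel τ ≤ lcmLabel σ := Finset.sup_mono hτσ
    have key : ∀ π : Finset (V →₀ ℕ), π.Nonempty → π ⊆ ρ ∪ σ → lcmLabel π = lcmLabel σ →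
        π = σ := fun π hn hπ he => hu π ⟨hn, fun x hx => by
          rcases Finset.mem_union.1 (hπ hx) with h | h
          · exact hρ.2 h
          · exact hσ.2 h⟩ he
    have h1 : ρ ∪ (σ \ τ) = σ := by
      refine key _ (hρ.1.mono Finset.subset_union_left)
        (Finset.union_subset_union le_rfl Finset.sdiff_subset) ?_
      rw [lcmLabel_union, hl, ← lcmLabel_union, hsplit]
    have hρσ : ρ ⊆ σ := h1 ▸ Finset.subset_union_left
    have hτρ : τ ⊆ ρ := fun x hx => by
      have hx' : x ∈ ρ ∪ (σ \ τ) := h1.symm ▸ hτσ hx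
      rcases Finset.mem_union.1 hx' with h | h
      · exact h
      · exact absurd hx (Finset.mem_sdiff.1 h).2
    have h2 : τ ∪ (σ \ ρ) = σ := by
      refine key _ (hτ.mono Finset.subset_union_left)
        (Finset.union_subset (hτσ.trans Finset.subset_union_right)
          (Finset.sdiff_subset.trans Finset.subset_union_right)) ?_
      rw [lcmLabel_union, ← hl, ← lcmLabel_union, Finset.union_sdiff_of_subset hρσ]
    refine Finset.Subset.antisymm (fun x hx => ?_) hτρ
    have hx' : x ∈ τ ∪ (σ \ ρ) := h2.symm ▸ hρσ hx
    rcases Finset.mem_union.1 hx' with h | h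
    · exact h
    · exact absurd hx (Finset.mem_sdiff.1 h).2

/-- The `n`-dimensional faces of a simplicial complex. -/
abbrev dimFaces {α : Type*} (Δ : PreAbstractSimplicialComplex α) (n : ℕ) : Type _ :=
  {τ : Finset α // τ ∈ Δ.faces ∧ τ.card = n + 1}

open Classical in
/-- The facet of an `(n+1)`-dimensional face `τ` opposite to its vertex `v`. -/
def eraseVertex {α : Type*} {Δ : PreAbstractSimplicialComplex α} {n : ℕ}
    (τ : dimFaces Δ (n + 1)) (v : {x // x ∈ τ.1}) : dimFaces Δ n :=
  ⟨τ.1.erase v.1, by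
    have hc : (τ.1.erase v.1).card = n + 1 := by
      rw [Finset.card_erase_of_mem v.2, τ.2.2]; rfl
    exact ⟨(Δ.isRelLowerSet_faces τ.2.1).2 (Finset.erase_subset _ _)
      (Finset.card_pos.1 (by omega)), hc⟩⟩

open Classical in
/-- The incidence sign of the facet of `τ` opposite to the vertex `v`, for the orientation of all
simplices coming from one fixed total order of the vertices (`(-1) ^ i` if `v` is the `i`-th
vertex of `τ`, counted from `0`). -/
def incidenceSign {α : Type*} (τ : Finset α) (v : α) : ℤ :=
  (-1) ^ (τ.filter (fun u => WellOrderingRel u v)).card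

/-- The differential in homological degree `n + 1` of the homogenized chain complex of a
simplicial complex `Δ` whose vertices are monomials: it sends the basis element of a face `τ` to
the sum of `± (m_τ / m_{τ \ v}) e_{τ \ v}` over the vertices `v` of `τ`, where `m_τ` is the lcm of
the vertices of `τ`. -/
def homogDiff (k : Type*) [Field k] {V : Type*} (Δ : PreAbstractSimplicialComplex (V →₀ ℕ))
    (n : ℕ) : (dimFaces Δ (n + 1) →₀ MvPolynomial V k) →ₗ[MvPolynomial V k]
      (dimFaces Δ n →₀ MvPolynomial V k) :=
  Finsupp.linearCombination (MvPolynomial V k) fun τ =>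
    ∑ v ∈ τ.1.attach, Finsupp.single (eraseVertex τ v)
      (monomial (lcmLabel τ.1 - lcmLabel (eraseVertex τ v).1) (incidenceSign τ.1 v.1 : k))

/-- The augmentation of the homogenized chain complex: a vertex is sent to the monomial it is
labelled with. -/
def homogAug (k : Type*) [Field k] {V : Type*} (Δ : PreAbstractSimplicialComplex (V →₀ ℕ)) :
    (dimFaces Δ 0 →₀ MvPolynomial V k) →ₗ[MvPolynomial V k] MvPolynomial V k :=
  Finsupp.linearCombination (MvPolynomial V k) fun τ => monomial (lcmLabel τ.1) (1 : k)

/-- `Δ` supports a free resolution of the monomial ideal `I`: the homogenized chain complex of `Δ`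
is exact, and the image of its augmentation is `I`. -/
def SupportsFreeResolution {k : Type*} [Field k] {V : Type*}
    (Δ : PreAbstractSimplicialComplex (V →₀ ℕ)) (I : Ideal (MvPolynomial V k)) : Prop :=
  LinearMap.range (homogAug k Δ) = I ∧
  Function.Exact (homogDiff k Δ 0) (homogAug k Δ) ∧
  ∀ n, Function.Exact (homogDiff k Δ (n + 1)) (homogDiff k Δ n)

/-- `I` has a Scarf resolution: its Scarf complex supports a free resolution of `I`. -/
def HasScarfResolution {k : Type*} [Field k] {V : Type*} (I : Ideal (MvPolynomial V k)) : Prop :=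
  SupportsFreeResolution (scarfComplex I) I

/-- A graph, seen as a simplicial complex of dimension at most one. -/
def graphComplex {W : Type*} (H : SimpleGraph W) : PreAbstractSimplicialComplex W where
  faces := {τ | ∃ v w, (v = w ∨ H.Adj v w) ∧ (τ : Set W) = {v, w}}
  isRelLowerSet_faces := by
    classical
    rintro τ ⟨v, w, h, e⟩
    have e' : τ = {v, w} := by ext x; simpa using Set.ext_iff.1 e x
    subst e'
    refine ⟨⟨v, by simp⟩, fun ρ hρ hn => ?_⟩
    by_cases hv : v ∈ ρ <;> by_cases hw : w ∈ ρ
    · refine ⟨v, w, h, ?_⟩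
      ext x; have := @hρ x; simp at this ⊢; grind
    · refine ⟨v, v, Or.inl rfl, ?_⟩
      ext x; have := @hρ x; simp at this ⊢; grind
    · refine ⟨w, w, Or.inl rfl, ?_⟩
      ext x; have := @hρ x; simp at this ⊢; grind
    · obtain ⟨x, hx⟩ := hn
      have := hρ hx; simp at this; grind

open Classical in
/-- `ℓ` identifies the graph `H`, as a simplicial complex of dimension at most one, with the whole
complex `Δ`: distinct vertices of `H` have distinct images under `ℓ`, and the faces of `Δ` are
exactly the images of the vertices and of the edges of `H`. -/
def IsGraphVia {W α : Type*} (Δ : PreAbstractSimplicialComplex α) (H : SimpleGraph W)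
    (ℓ : W → α) : Prop :=
  Function.Injective ℓ ∧ Δ = (graphComplex H).map ℓ

/-- The (vertices and edges of the) `t × t` grid of squares. The vertex `(r, s)` is the one in row
`r` and column `s`, where `0 ≤ r, s ≤ t`. -/
def gridGraph (t : ℕ) : SimpleGraph (Fin (t + 1) × Fin (t + 1)) :=
  pathGraph (t + 1) □ pathGraph (t + 1)

/-- The upper triangular portion of the `t × t` grid of squares. -/
def upperGridGraph (t : ℕ) :
    SimpleGraph {p : Fin (t + 1) × Fin (t + 1) | p.1 ≤ p.2} :=
  (gridGraph t).induce _

/-- The monomial `a^(t-s) b^(t-r) c^s d^r` at row `r` and column `s` of the grid. -/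
def gridLabel {V : Type*} (a b c d : V) (t : ℕ) (p : Fin (t + 1) × Fin (t + 1)) : V →₀ ℕ :=
  Finsupp.single a (t - p.2.val) + Finsupp.single b (t - p.1.val) +
    Finsupp.single c p.2.val + Finsupp.single d p.1.val

/-- The `s`-th monomial, for `0 ≤ s < 3t`, in the closed walk
`a^t b^t, a^t b^(t-1) c, …, a^t c^t, a^t c^(t-1) d, …, a^t d^t, a^t d^(t-1) b, …, a^t d b^(t-1)`. -/
def clawCycleLabel {V : Type*} (a b c d : V) (t s : ℕ) : V →₀ ℕ :=
  Finsupp.single a t +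
    if s ≤ t then Finsupp.single b (t - s) + Finsupp.single c s
    else if s ≤ 2 * t then Finsupp.single c (2 * t - s) + Finsupp.single d (s - t)
    else Finsupp.single d (3 * t - s) + Finsupp.single b (s - 2 * t)

end

/-! The minimal generators of `I ^ t` are the products of `t` edges; they all have degree `2 * t`,
so none divides another. Hence two of them, `m ≠ n`, span a Scarf face exactly when no third
generator divides `lcm(m, n)`. If the graph of these pairs has no triangle, there are no larger
faces, because a Scarf face has only Scarf faces as subsets: the Scarf complex is that graph
(`isGraphVia_scarfComplex`).

In each case the generators become lattice points, and dividing the lcm becomes a box condition. For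
the path and the square the points lie in a grid and the box is the rectangle spanned by two points
(`grid_adj_iff`). For the claw they are the points of a triangle `a + b + c = t` below a
coordinatewise maximum (`side_adj_iff`). For the triangle graph, the complementary exponents `t - x
i` fill the same lattice triangle, and maximum turns into minimum (`exists_third_ge_min`).

Resolutions fail by exactness. Two generators always have a syzygy, which nothing hits if there are
no edges; a cycle of edges gives a syzygy of edges, which nothing hits if there are no 2-faces. -/

open MvPolynomial SimpleGraph
open scoped Pointwise

/-! ### Minimal generators of powers of an edge ideal -/

/-- The exponent vectors of the generators of the edge ideal. -/
def edgeExponents {V : Type*} (G : SimpleGraph V) : Set (V →₀ ℕ) :=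
  {u | ∃ v w, G.Adj v w ∧ u = Finsupp.single v 1 + Finsupp.single w 1}

theorem edgeIdeal_eq_span_monomial (k : Type*) [Field k] {V : Type*} (G : SimpleGraph V) :
    edgeIdeal k G = Ideal.span ((fun u => monomial u (1 : k)) '' edgeExponents G) := by
  unfold edgeIdeal
  congr 1
  ext f
  constructor
  · rintro ⟨v, w, h, rfl⟩
    exact ⟨_, ⟨v, w, h, rfl⟩, by simp [X, monomial_mul]⟩
  · rintro ⟨_, ⟨v, w, h, rfl⟩, rfl⟩
    exact ⟨v, w, h, by simp [X, monomial_mul]⟩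

theorem span_monomial_pow (k : Type*) [Field k] {V : Type*} (S : Set (V →₀ ℕ)) (t : ℕ) :
    Ideal.span ((fun u => monomial u (1 : k)) '' S) ^ t =
      Ideal.span ((fun u => monomial u (1 : k)) '' (t • S)) := by
  induction t with
  | zero => simp
  | succ t ih =>
    rw [pow_succ, ih, Ideal.span_mul_span', succ_nsmul]
    congr 1
    ext f
    simp only [Set.mem_mul, Set.mem_image, Set.mem_add]
    constructor
    · rintro ⟨_, ⟨x, hx, rfl⟩, _, ⟨y, hy, rfl⟩, rfl⟩
      exact ⟨x + y, ⟨x, hx, y, hy, rfl⟩, by simp [monomial_mul]⟩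
    · rintro ⟨_, ⟨x, hx, y, hy, rfl⟩, rfl⟩
      exact ⟨_, ⟨x, hx, rfl⟩, _, ⟨y, hy, rfl⟩, by simp [monomial_mul]⟩

theorem degree_of_mem_nsmul_edgeExponents {V : Type*} {G : SimpleGraph V} {t : ℕ} {u : V →₀ ℕ}
    (hu : u ∈ t • edgeExponents G) : u.degree = 2 * t := by
  induction t generalizing u with
  | zero => simp_all
  | succ t ih =>
    rw [succ_nsmul] at hu
    obtain ⟨x, hx, _, ⟨v, w, -, rfl⟩, rfl⟩ := hu
    simp only [map_add, ih hx, Finsupp.degree_single]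
    ring

theorem Finsupp.eq_of_le_of_degree_eq {V : Type*} {x y : V →₀ ℕ} (h : x ≤ y)
    (hd : x.degree = y.degree) : x = y := by
  obtain ⟨z, rfl⟩ := le_iff_exists_add.1 h
  simp only [map_add] at hd
  have hz : z.degree = 0 := by omega
  simp [(Finsupp.degree_eq_zero_iff z).1 hz]

/-- All products of `t` edges have the same degree, so divisibility among them is equality and each
one is minimal. -/
theorem minGens_edgeIdeal_pow (k : Type*) [Field k] {V : Type*} (G : SimpleGraph V) (t : ℕ) :
    minGens (edgeIdeal k G ^ t) = t • edgeExponents G := by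
  have key : ∀ u : V →₀ ℕ, monomial u (1 : k) ∈ edgeIdeal k G ^ t ↔
      ∃ x ∈ t • edgeExponents G, x ≤ u := fun u => by
    rw [edgeIdeal_eq_span_monomial, span_monomial_pow, mem_ideal_span_monomial_image]
    classical simp [coeff_monomial]
  ext m
  simp only [minGens, Set.mem_ofPred_eq, Minimal, key]
  constructor
  · rintro ⟨⟨x, hx, hxm⟩, h⟩
    exact le_antisymm hxm (h ⟨x, hx, le_rfl⟩ hxm) ▸ hx
  · refine fun hm => ⟨⟨m, hm, le_rfl⟩, ?_⟩
    rintro y ⟨x, hx, hxy⟩ hym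
    exact (Finsupp.eq_of_le_of_degree_eq (hxy.trans hym) (by
      rw [degree_of_mem_nsmul_edgeExponents hx, degree_of_mem_nsmul_edgeExponents hm])) ▸ hxy

theorem isGraphVia_iff {α W : Type*} {Δ : PreAbstractSimplicialComplex α} {H : SimpleGraph W}
    {ℓ : W → α} : IsGraphVia Δ H ℓ ↔ Function.Injective ℓ ∧ ∀ τ, τ ∈ Δ.faces ↔
      ∃ v w, (v = w ∨ H.Adj v w) ∧ (τ : Set α) = {ℓ v, ℓ w} := by
  classical
  refine and_congr_right fun _ => PreAbstractSimplicialComplex.ext_iff.trans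
    (Set.ext_iff.trans (forall_congr' fun τ => iff_congr Iff.rfl ?_))
  constructor
  · rintro ⟨σ, ⟨v, w, hvw, hσ⟩, rfl⟩
    refine ⟨v, w, hvw, ?_⟩
    simp [hσ, Set.image_pair]
  · rintro ⟨v, w, hvw, hτ⟩
    refine ⟨{v, w}, ⟨v, w, hvw, by simp⟩, ?_⟩
    ext x
    simpa [eq_comm] using (Set.ext_iff.1 hτ x).symm

/-! ### Scarf complexes that are graphs -/

section Scarf

variable {k : Type*} [Field k] {V : Type*} {I : Ideal (MvPolynomial V k)}

theorem eq_of_le_of_mem_minGens {x y : V →₀ ℕ} (hx : x ∈ minGens I) (hy : y ∈ minGens I)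
    (h : x ≤ y) : x = y :=
  le_antisymm h (hy.2 hx.1 h)

/-- Inserting `x` into `τ` does not change the label, so uniqueness of the label forces `x` to be
there already. -/
theorem mem_of_le_lcmLabel_of_mem_scarfComplex {τ : Finset (V →₀ ℕ)}
    (hτ : τ ∈ (scarfComplex I).faces) {x : V →₀ ℕ} (hx : x ∈ minGens I) (hxτ : x ≤ lcmLabel τ) :
    x ∈ τ := by
  classical
  have h := hτ.2 (insert x τ) ⟨by simp, by simpa [Set.insert_subset_iff, hx] using hτ.1.2⟩
    (by simpa [lcmLabel] using hxτ)
  exact h ▸ Finset.mem_insert_self x τ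

theorem singleton_mem_scarfComplex {m : V →₀ ℕ} (hm : m ∈ minGens I) :
    {m} ∈ (scarfComplex I).faces := by
  refine ⟨⟨by simp, by simpa using hm⟩, fun ρ hρ h => ?_⟩
  refine hρ.1.subset_singleton_iff.1 fun x hx => ?_
  have hle : x ≤ lcmLabel ρ := Finset.le_sup (f := id) hx
  rw [h] at hle
  exact Finset.mem_singleton.2 (eq_of_le_of_mem_minGens (hρ.2 hx) hm (by simpa [lcmLabel] using hle))

-- A face with label `m ⊔ n` has all its vertices in `{m, n}`. It cannot omit one of two distinct
-- generators, since the other would then be divisible by it.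
open Classical in
theorem pair_mem_scarfComplex {m n : V →₀ ℕ} (hm : m ∈ minGens I) (hn : n ∈ minGens I)
    (h : ∀ x ∈ minGens I, x ≤ m ⊔ n → x = m ∨ x = n) : {m, n} ∈ (scarfComplex I).faces := by
  refine ⟨⟨by simp, by simp [Set.insert_subset_iff, hm, hn]⟩, fun ρ hρ hl => ?_⟩
  have hl' : lcmLabel ρ = m ⊔ n := by simpa [lcmLabel] using hl
  have hsub : ∀ x ∈ ρ, x = m ∨ x = n := fun x hx =>
    h x (hρ.2 hx) (hl' ▸ Finset.le_sup (f := id) hx)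
  have aux : ∀ y, (∀ x ∈ ρ, x = y) → y = m ⊔ n := fun y hy => by
    rw [← hl', (Finset.eq_singleton_iff_nonempty_unique_mem.2 ⟨hρ.1, hy⟩)]
    simp [lcmLabel]
  by_cases hmn : m = n
  · subst hmn
    have : ρ = {m} := Finset.eq_singleton_iff_nonempty_unique_mem.2
      ⟨hρ.1, fun x hx => by simpa using hsub x hx⟩
    simp [this]
  have hmρ : m ∈ ρ := by
    by_contra hmρ
    have e := aux n fun x hx => (hsub x hx).resolve_left fun e => hmρ (e ▸ hx)
    exact hmn (eq_of_le_of_mem_minGens hm hn (e ▸ le_sup_left))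
  have hnρ : n ∈ ρ := by
    by_contra hnρ
    have e := aux m fun x hx => (hsub x hx).resolve_right fun e => hnρ (e ▸ hx)
    exact hmn (eq_of_le_of_mem_minGens hn hm (e ▸ le_sup_right)).symm
  ext x
  simp only [Finset.mem_insert, Finset.mem_singleton]
  exact ⟨hsub x, by rintro (rfl | rfl) <;> assumption⟩

/-- A criterion for the Scarf complex to be a given triangle-free graph. -/
theorem isGraphVia_scarfComplex {W : Type*} {H : SimpleGraph W} {ℓ : W → V →₀ ℕ}
    (hinj : Function.Injective ℓ) (hrange : Set.range ℓ = minGens I)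
    (hadj : ∀ v w, v ≠ w → (H.Adj v w ↔ ∀ u, ℓ u ≤ ℓ v ⊔ ℓ w → u = v ∨ u = w))
    (hfree : ∀ u v w, H.Adj u v → H.Adj v w → ¬ H.Adj u w) :
    IsGraphVia (scarfComplex I) H ℓ := by
  classical
  have hmem : ∀ v, ℓ v ∈ minGens I := fun v => hrange ▸ ⟨v, rfl⟩
  refine isGraphVia_iff.2 ⟨hinj, fun τ => ⟨fun hτ => ?_, ?_⟩⟩
  -- Any two vertices of a Scarf face are adjacent in `H`; as `H` has no triangle, the face has at
  -- most two vertices.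
  · have hedge : ∀ v w, v ≠ w → ℓ v ∈ τ → ℓ w ∈ τ → H.Adj v w := fun v w hvw hv hw => by
      have hp : ({ℓ v, ℓ w} : Finset (V →₀ ℕ)) ∈ (scarfComplex I).faces :=
        ((scarfComplex I).isRelLowerSet_faces hτ).2
          (by simp [Finset.insert_subset_iff, hv, hw]) (by simp)
      refine (hadj v w hvw).2 fun u hu => ?_
      have := mem_of_le_lcmLabel_of_mem_scarfComplex hp (hmem u) (by simpa [lcmLabel] using hu)
      simpa [hinj.eq_iff] using this
    have hlift : ∀ x ∈ τ, ∃ v, ℓ v = x := fun x hx => by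
      have : x ∈ Set.range ℓ := hrange ▸ hτ.1.2 hx
      exact this
    obtain ⟨x, hx⟩ := hτ.1.1
    obtain ⟨v, rfl⟩ := hlift x hx
    by_cases hw : ∃ w, w ≠ v ∧ ℓ w ∈ τ
    · obtain ⟨w, hwv, hw⟩ := hw
      refine ⟨v, w, Or.inr (hedge v w hwv.symm hx hw), ?_⟩
      refine Set.Subset.antisymm (fun y hy => ?_) (by simp [Set.insert_subset_iff, hx, hw])
      obtain ⟨u, rfl⟩ := hlift y hy
      by_contra hne
      simp only [Set.mem_insert_iff, Set.mem_singleton_iff, not_or] at hne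
      exact hfree u v w (hedge _ _ (fun e => hne.1 (e ▸ rfl)) hy hx) (hedge _ _ hwv.symm hx hw)
        (hedge _ _ (fun e => hne.2 (e ▸ rfl)) hy hw)
    · push Not at hw
      refine ⟨v, v, Or.inl rfl, ?_⟩
      refine Set.Subset.antisymm (fun y hy => ?_) (by simp [hx])
      obtain ⟨u, rfl⟩ := hlift y hy
      by_contra hne
      exact hw u (fun e => hne (e ▸ by simp)) hy
  · rintro ⟨v, w, hvw, hτ⟩
    have e : τ = {ℓ v, ℓ w} := by ext x; simpa using Set.ext_iff.1 hτ x
    rw [e]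
    rcases eq_or_ne v w with rfl | hne
    · simpa using singleton_mem_scarfComplex (hmem v)
    · refine pair_mem_scarfComplex (hmem v) (hmem w) fun x hx hle => ?_
      rw [← hrange] at hx
      obtain ⟨u, rfl⟩ := hx
      simpa [hinj.eq_iff] using (hadj v w hne).1 (hvw.resolve_left hne) u hle

end Scarf

/-! ### One-dimensional complexes that support no resolution -/

section Resolution

variable {k : Type*} [Field k] {V : Type*} {I : Ideal (MvPolynomial V k)}
  {Δ : PreAbstractSimplicialComplex (V →₀ ℕ)} {W : Type*} {H : SimpleGraph W} {ℓ : W → V →₀ ℕ}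

open Classical in
theorem IsGraphVia.exists_of_mem (h : IsGraphVia Δ H ℓ) {τ : Finset (V →₀ ℕ)}
    (hτ : τ ∈ Δ.faces) : ∃ v w, (v = w ∨ H.Adj v w) ∧ τ = {ℓ v, ℓ w} := by
  obtain ⟨v, w, hvw, e⟩ := ((isGraphVia_iff.1 h).2 τ).1 hτ
  exact ⟨v, w, hvw, by ext x; simpa using Set.ext_iff.1 e x⟩

open Classical in
theorem IsGraphVia.pair_mem (h : IsGraphVia Δ H ℓ) {v w : W} (hvw : v = w ∨ H.Adj v w) :
    {ℓ v, ℓ w} ∈ Δ.faces := by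
  exact ((isGraphVia_iff.1 h).2 _).2 ⟨v, w, hvw, by simp⟩

theorem IsGraphVia.isEmpty_dimFaces_two (h : IsGraphVia Δ H ℓ) : IsEmpty (dimFaces Δ 2) := by
  classical
  refine ⟨fun τ => ?_⟩
  obtain ⟨v, w, -, e⟩ := h.exists_of_mem τ.2.1
  have := τ.2.2
  rw [e] at this
  have := Finset.card_le_two (a := ℓ v) (b := ℓ w)
  omega

theorem IsGraphVia.isEmpty_dimFaces_one {ℓ : W → V →₀ ℕ} (h : IsGraphVia Δ ⊥ ℓ) :
    IsEmpty (dimFaces Δ 1) := by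
  classical
  refine ⟨fun τ => ?_⟩
  obtain ⟨v, w, hvw, e⟩ := h.exists_of_mem τ.2.1
  have := τ.2.2
  obtain rfl : v = w := by simpa using hvw
  simp [e] at this

/-- The vertex of the complex labelled by a vertex of the graph. -/
def IsGraphVia.vertex (h : IsGraphVia Δ H ℓ) (v : W) : dimFaces Δ 0 :=
  ⟨{ℓ v}, by classical simpa using h.pair_mem (Or.inl (rfl : v = v)), by simp⟩

theorem IsGraphVia.vertex_injective (h : IsGraphVia Δ H ℓ) : Function.Injective h.vertex := by
  intro v w e
  have := congrArg Subtype.val e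
  exact h.1 (Finset.singleton_injective this)

/-- The relation `m_w e_v - m_v e_w` lies in the kernel of the augmentation, but without edges the
differential into degree 0 vanishes. -/
theorem not_supportsFreeResolution_of_isGraphVia_bot [Nontrivial W]
    (h : IsGraphVia Δ (⊥ : SimpleGraph W) ℓ) : ¬ SupportsFreeResolution Δ I := by
  rintro ⟨-, hex, -⟩
  have := h.isEmpty_dimFaces_one
  obtain ⟨v, w, hvw⟩ := exists_pair_ne W
  have hz : homogAug k Δ (Finsupp.single (h.vertex v) (monomial (ℓ w) 1) -
      Finsupp.single (h.vertex w) (monomial (ℓ v) 1)) = 0 := by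
    simp [homogAug, IsGraphVia.vertex, lcmLabel, monomial_mul, add_comm]
  obtain ⟨x, hx⟩ := (hex _).1 hz
  rw [Subsingleton.elim x 0, map_zero] at hx
  have := DFunLike.congr_fun hx (h.vertex v)
  simp only [Finsupp.coe_zero, Pi.zero_apply, Finsupp.coe_sub, Pi.sub_apply,
    Finsupp.single_eq_same, Finsupp.single_eq_of_ne (h.vertex_injective.ne hvw), sub_zero] at this
  exact one_ne_zero (monomial_eq_zero.1 this.symm)

open Classical in
/-- The edge of the complex labelled by an edge of the graph. -/
noncomputable def IsGraphVia.edge (h : IsGraphVia Δ H ℓ) {v w : W} (hvw : H.Adj v w) : dimFaces Δ 1 :=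
  ⟨{ℓ v, ℓ w}, h.pair_mem (Or.inr hvw), Finset.card_pair (h.1.ne hvw.ne)⟩

theorem incidenceSign_pair {α : Type*} [DecidableEq α] {x y : α} (h : x ≠ y) :
    incidenceSign {x, y} x = -incidenceSign {x, y} y ∧ incidenceSign {x, y} y ^ 2 = 1 := by
  have hxx : ¬ WellOrderingRel x x := irrefl x
  have hyy : ¬ WellOrderingRel y y := irrefl y
  rcases trichotomous_of WellOrderingRel x y with hxy | hxy | hxy
  · have : ¬ WellOrderingRel y x := asymm hxy
    simp [incidenceSign, Finset.filter_insert, Finset.filter_singleton, *]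
  · exact absurd hxy h
  · have : ¬ WellOrderingRel x y := asymm hxy
    simp [incidenceSign, Finset.filter_insert, Finset.filter_singleton, *]

-- Scaling by the sign, which is its own inverse, orients the edge from `w` to `v` whatever the
-- order of the vertices. Lifting to a common multidegree `M` makes these boundaries telescope along
-- a cycle.
open Classical in
theorem homogDiff_single_edge (h : IsGraphVia Δ H ℓ) {v w : W} (hvw : H.Adj v w)
    {M : V →₀ ℕ} (hv : ℓ v ≤ M) (hw : ℓ w ≤ M) :
    homogDiff k Δ 0 (Finsupp.single (h.edge hvw)
      (monomial (M - (ℓ v ⊔ ℓ w)) (incidenceSign {ℓ v, ℓ w} (ℓ w) : k))) =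
    Finsupp.single (h.vertex v) (monomial (M - ℓ v) 1) -
      Finsupp.single (h.vertex w) (monomial (M - ℓ w) 1) := by
  have hne : ℓ v ≠ ℓ w := h.1.ne hvw.ne
  obtain ⟨hs, hs2⟩ := incidenceSign_pair hne
  have hval : (h.edge hvw).1 = {ℓ v, ℓ w} := rfl
  have hev : ∀ (x : {x // x ∈ (h.edge hvw).1}), x.1 = ℓ v →
      eraseVertex (h.edge hvw) x = h.vertex w := by
    rintro ⟨x, hx⟩ rfl
    refine Subtype.ext ?_
    ext y
    simp only [eraseVertex, IsGraphVia.edge, IsGraphVia.vertex, Finset.mem_erase,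
      Finset.mem_insert, Finset.mem_singleton]
    grind
  have hew : ∀ (x : {x // x ∈ (h.edge hvw).1}), x.1 = ℓ w →
      eraseVertex (h.edge hvw) x = h.vertex v := by
    rintro ⟨x, hx⟩ rfl
    refine Subtype.ext ?_
    ext y
    simp only [eraseVertex, IsGraphVia.edge, IsGraphVia.vertex, Finset.mem_erase,
      Finset.mem_insert, Finset.mem_singleton]
    grind
  have hatt : (h.edge hvw).1.attach = {⟨ℓ v, by simp [hval]⟩, ⟨ℓ w, by simp [hval]⟩} := by
    ext ⟨x, hx⟩
    simpa [hval] using hx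
  have hsub : ∀ {a b : V →₀ ℕ}, a ≤ b → b ≤ M → M - b + (b - a) = M - a := fun hab hb => by
    rw [tsub_add_tsub_cancel hb hab]
  have hlv : lcmLabel (h.vertex v).1 = ℓ v := by simp [IsGraphVia.vertex, lcmLabel]
  have hlw : lcmLabel (h.vertex w).1 = ℓ w := by simp [IsGraphVia.vertex, lcmLabel]
  have hle : lcmLabel (h.edge hvw).1 = ℓ v ⊔ ℓ w := by simp [IsGraphVia.edge, lcmLabel]
  have hs2' : (incidenceSign {ℓ v, ℓ w} (ℓ w) : k) * incidenceSign {ℓ v, ℓ w} (ℓ w) = 1 := by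
    rw [← sq]; exact_mod_cast congrArg (Int.cast : ℤ → k) hs2
  rw [homogDiff, Finsupp.linearCombination_single, hatt, Finset.sum_pair (by simpa using hne),
    hev _ rfl, hew _ rfl, hlv, hlw, hle]
  simp only [hval, hs, smul_add, Finsupp.smul_single, smul_eq_mul, monomial_mul,
    hsub le_sup_left (sup_le hv hw), hsub le_sup_right (sup_le hv hw), Int.cast_neg, mul_neg, hs2']
  simp [sub_eq_add_neg, add_comm]

/-- Without 2-faces, exactness would make the differential on edges injective; the signed sum of the
edges of the cycle, lifted to a common multidegree, is a nonzero element of its kernel. -/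
theorem not_supportsFreeResolution_of_cycle (h : IsGraphVia Δ H ℓ) {n : ℕ} (f : Fin (n + 3) → W)
    (hf : Function.Injective f) (hadj : ∀ i, H.Adj (f i) (f (i + 1))) :
    ¬ SupportsFreeResolution Δ I := by
  classical
  rintro ⟨-, -, hex⟩
  have := h.isEmpty_dimFaces_two
  let M : V →₀ ℕ := Finset.univ.sup fun i => ℓ (f i)
  have hM : ∀ i, ℓ (f i) ≤ M := fun i => Finset.le_sup (f := fun i => ℓ (f i)) (Finset.mem_univ i)
  let c : Fin (n + 3) → MvPolynomial V k := fun i => monomial (M - (ℓ (f i) ⊔ ℓ (f (i + 1))))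
    (incidenceSign {ℓ (f i), ℓ (f (i + 1))} (ℓ (f (i + 1))) : k)
  have hz : homogDiff k Δ 0 (∑ i, Finsupp.single (h.edge (hadj i)) (c i)) = 0 := by
    rw [map_sum]
    simp only [c, homogDiff_single_edge h (hadj _) (hM _) (hM _), Finset.sum_sub_distrib]
    rw [sub_eq_zero]
    -- The sums over initial and final vertices agree by the cyclic shift of the indices.
    exact (Equiv.sum_comp (Equiv.addRight 1)
      fun i => Finsupp.single (h.vertex (f i)) (monomial (M - ℓ (f i)) (1 : k))).symm
  obtain ⟨x, hx⟩ := (hex 0 _).1 hz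
  rw [Subsingleton.elim x 0, map_zero] at hx
  have h0 := DFunLike.congr_fun hx (h.edge (hadj 0))
  -- Length at least 3 matters here: in a closed walk of length 2 both edges coincide and could
  -- cancel.
  have hinj : ∀ i, i ≠ 0 → h.edge (hadj i) ≠ h.edge (hadj 0) := by
    intro i hi e
    have e' : ({ℓ (f i), ℓ (f (i + 1))} : Finset (V →₀ ℕ)) = {ℓ (f 0), ℓ (f (0 + 1))} :=
      congrArg Subtype.val e
    have h1 : ℓ (f i) ∈ ({ℓ (f 0), ℓ (f (0 + 1))} : Finset (V →₀ ℕ)) := e' ▸ by simp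
    have h2 : ℓ (f (i + 1)) ∈ ({ℓ (f 0), ℓ (f (0 + 1))} : Finset (V →₀ ℕ)) := e' ▸ by simp
    simp only [Finset.mem_insert, Finset.mem_singleton, h.1.eq_iff, hf.eq_iff, hi, zero_add,
      false_or] at h1 h2
    subst h1
    rcases h2 with h2 | h2
    · have := congrArg Fin.val h2
      simp only [Fin.val_add, Fin.val_one, Fin.val_zero] at this
      rw [Nat.mod_eq_of_lt (by omega)] at this
      omega
    · simp at h2
  rw [Finsupp.finsetSum_apply, Finset.sum_eq_single 0
    (fun i _ hi => Finsupp.single_eq_of_ne (hinj i hi).symm) (by simp), Finsupp.single_eq_same] at h0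
  have hs := (incidenceSign_pair (h.1.ne (hadj 0).ne)).2
  have hc := monomial_eq_zero.1 h0.symm
  have := congrArg (Int.cast : ℤ → k) hs
  rw [Int.cast_pow, hc] at this
  simp at this

end Resolution

/-! ### Coordinates from a model graph -/

section Label

variable {ι V : Type*} [Finite ι]

/-- The exponent vector on `V` with prescribed coordinates along `e`. -/
noncomputable def label (e : ι ≃ V) (x : ι → ℕ) : V →₀ ℕ :=
  Finsupp.equivMapDomain e (Finsupp.equivFunOnFinite.symm x)

theorem label_apply (e : ι ≃ V) (x : ι → ℕ) (i : ι) : label e x (e i) = x i := by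
  simp [label, Finsupp.equivMapDomain_apply]

theorem label_injective (e : ι ≃ V) : Function.Injective (label e) := fun x y h => by
  ext i
  rw [← label_apply e x, h, label_apply]

theorem label_le_sup_iff (e : ι ≃ V) (x y z : ι → ℕ) :
    label e x ≤ label e y ⊔ label e z ↔ ∀ i, x i ≤ max (y i) (z i) := by
  rw [Finsupp.le_def, ← e.forall_congr_right]
  simp [label_apply]

theorem eq_label_iff (e : ι ≃ V) (u : V →₀ ℕ) (x : ι → ℕ) :
    u = label e x ↔ ∀ i, u (e i) = x i := by
  rw [DFunLike.ext_iff, ← e.forall_congr_right]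
  simp [label_apply]

/-- The monomials generating the powers of an edge ideal, from a recursive description of their
coordinates. -/
theorem nsmul_edgeExponents_eq {K : SimpleGraph ι} [DecidableEq ι] {G : SimpleGraph V}
    (φ : K ≃g G) (P : ℕ → (ι → ℕ) → Prop) (h0 : ∀ x, P 0 x ↔ ∀ i, x i = 0)
    (hs : ∀ t y, P (t + 1) y ↔ ∃ i j, K.Adj i j ∧ 1 ≤ y i ∧ 1 ≤ y j ∧
      P t fun l => y l - (if l = i then 1 else 0) - if l = j then 1 else 0) (t : ℕ) :
    t • edgeExponents G = label φ.toEquiv '' {x | P t x} := by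
  classical
  induction t with
  | zero =>
    ext u
    simp only [zero_nsmul, Set.mem_zero, Set.mem_image, Set.mem_ofPred_eq, h0]
    constructor
    · rintro rfl
      exact ⟨0, by simp, ((eq_label_iff _ _ _).2 (by simp)).symm⟩
    · rintro ⟨x, hx, rfl⟩
      exact ((eq_label_iff _ _ _).2 (by simp [hx])).symm
  | succ t ih =>
    ext u
    rw [succ_nsmul, ih]
    simp only [Set.mem_add, Set.mem_image, Set.mem_ofPred_eq]
    constructor
    · rintro ⟨_, ⟨x, hx, rfl⟩, _, ⟨v, w, hvw, rfl⟩, rfl⟩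
      obtain ⟨i, rfl⟩ := φ.surjective v
      obtain ⟨j, rfl⟩ := φ.surjective w
      have hij : K.Adj i j := φ.map_adj_iff.1 hvw
      refine ⟨fun l => x l + (if l = i then 1 else 0) + if l = j then 1 else 0,
        (hs _ _).2 ⟨i, j, hij, by simp; omega, by simp, ?_⟩, ?_⟩
      · convert hx using 2
        omega
      · refine ((eq_label_iff _ _ _).2 fun l => ?_).symm
        have := label_apply φ.toEquiv x l
        simp only [RelIso.coe_fn_toEquiv] at this
        simp [this, Finsupp.single_apply, eq_comm, add_assoc]
    · rintro ⟨y, hy, rfl⟩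
      obtain ⟨i, j, hij, hi, hj, hP⟩ := (hs _ _).1 hy
      refine ⟨_, ⟨_, hP, rfl⟩, _, ⟨φ i, φ j, φ.map_adj_iff.2 hij, rfl⟩, ?_⟩
      refine (eq_label_iff _ _ _).2 fun l => ?_
      have := label_apply φ.toEquiv
        (fun l => y l - (if l = i then 1 else 0) - if l = j then 1 else 0) l
      simp only [RelIso.coe_fn_toEquiv] at this
      -- With `i ≠ j` and both coordinates positive, the truncated subtractions lose nothing.
      have hne := hij.ne
      simp only [Finsupp.add_apply, RelIso.coe_fn_toEquiv, this, Finsupp.single_apply,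
        φ.injective.eq_iff]
      grind

/-- Reduces each case to arithmetic of the coordinate vectors `x w`. -/
theorem isGraphVia_label (k : Type*) [Field k] {G : SimpleGraph V} {t : ℕ} {e : ι ≃ V}
    {P : (ι → ℕ) → Prop} (hP : t • edgeExponents G = label e '' {x | P x})
    {W : Type*} {H : SimpleGraph W} {x : W → ι → ℕ} (hinj : Function.Injective x)
    (hx : ∀ y, P y ↔ ∃ w, x w = y)
    (hadj : ∀ v w, v ≠ w → (H.Adj v w ↔ ∀ u, (∀ i, x u i ≤ max (x v i) (x w i)) → u = v ∨ u = w))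
    (hfree : ∀ u v w, H.Adj u v → H.Adj v w → ¬ H.Adj u w) :
    IsGraphVia (scarfComplex (edgeIdeal k G ^ t)) H fun w => label e (x w) := by
  refine isGraphVia_scarfComplex ((label_injective e).comp hinj) ?_ ?_ hfree
  · rw [minGens_edgeIdeal_pow, hP]
    ext u
    simp only [Set.mem_range, Set.mem_image, Set.mem_ofPred_eq, hx]
    constructor
    · rintro ⟨w, rfl⟩
      exact ⟨_, ⟨w, rfl⟩, rfl⟩
    · rintro ⟨_, ⟨w, rfl⟩, rfl⟩
      exact ⟨w, rfl⟩
  · intro v w hvw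
    rw [hadj v w hvw]
    simp only [label_le_sup_iff]

end Label

/-! ### Regions of the grid: path and square -/

section Grid

/-- In a suitable region of the plane, two points span a box without further points of the region
if and only if they are adjacent in the grid. -/
theorem grid_adj_iff {P : ℕ → ℕ → Prop}
    (hmin : ∀ r s r' s', P r s → P r' s' → P (min r r') (min s s'))
    (hmax : ∀ r s r' s', P r s → P r' s' → P (min r r') (max s s'))
    (hrow : ∀ r s s' x, P r s → P r s' → s ≤ x → x ≤ s' → P r x)
    (hcol : ∀ r r' s x, P r s → P r' s → r ≤ x → x ≤ r' → P x s)
    {r s r' s' : ℕ} (hp : P r s) (hq : P r' s') (hne : ¬ (r = r' ∧ s = s')) :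
    ((r + 1 = r' ∨ r' + 1 = r) ∧ s = s' ∨ (s + 1 = s' ∨ s' + 1 = s) ∧ r = r') ↔
      ∀ x y, P x y → min r r' ≤ x → x ≤ max r r' → min s s' ≤ y → y ≤ max s s' →
        x = r ∧ y = s ∨ x = r' ∧ y = s' := by
  constructor
  · intro h x y _ _ _ _ _
    omega
  · intro h
    -- These two corners of the box lie on its lowest row and belong to the region, so each is one
    -- of the two given points. This forces `r = r'` or `s = s'`; a unit step towards the other
    -- point then forces adjacency.
    have h1 := h _ _ (hmin _ _ _ _ hp hq) (by omega) (by omega) (by omega) (by omega)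
    have h2 := h _ _ (hmax _ _ _ _ hp hq) (by omega) (by omega) (by omega) (by omega)
    rcases eq_or_ne r r' with rfl | hr
    · rcases lt_or_gt_of_ne (fun e => hne ⟨rfl, e⟩ : s ≠ s') with hs | hs
      · have := h r (s + 1) (hrow _ _ _ _ hp hq (by omega) hs) (by omega) (by omega) (by omega)
          (by omega)
        omega
      · have := h r (s' + 1) (hrow _ _ _ _ hq hp (by omega) hs) (by omega) (by omega) (by omega)
          (by omega)
        omega
    · obtain rfl : s = s' := by omega
      rcases lt_or_gt_of_ne hr with hs | hs
      · have := h (r + 1) s (hcol _ _ _ _ hp hq (by omega) hs) (by omega) (by omega) (by omega)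
          (by omega)
        omega
      · have := h (r' + 1) s (hcol _ _ _ _ hq hp (by omega) hs) (by omega) (by omega) (by omega)
          (by omega)
        omega

theorem gridLabel_eq_label {V : Type*} (e : Fin 4 ≃ V) (t : ℕ) (p : Fin (t + 1) × Fin (t + 1)) :
    gridLabel (e 0) (e 1) (e 2) (e 3) t p =
      label e ![t - p.2.val, t - p.1.val, p.2.val, p.1.val] := by
  refine (eq_label_iff _ _ _).2 fun i => ?_
  fin_cases i <;> simp [gridLabel]

theorem gridGraph_adj_iff {t : ℕ} {p q : Fin (t + 1) × Fin (t + 1)} :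
    (gridGraph t).Adj p q ↔
      (p.1.val + 1 = q.1.val ∨ q.1.val + 1 = p.1.val) ∧ p.2.val = q.2.val ∨
      (p.2.val + 1 = q.2.val ∨ q.2.val + 1 = p.2.val) ∧ p.1.val = q.1.val := by
  simp [gridGraph, boxProd_adj, pathGraph_adj, Fin.ext_iff]

/-- The Scarf complex is an induced subgraph of the grid as soon as the generators fill a suitable
region. -/
theorem isGraphVia_induce_gridGraph (k : Type*) [Field k] {V : Type*} {G : SimpleGraph V} {t : ℕ}
    {e : Fin 4 ≃ V} {P : ℕ → ℕ → Prop}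
    (hP : t • edgeExponents G =
      label e '' {x | x 0 + x 2 = t ∧ x 1 + x 3 = t ∧ P (x 3) (x 2)})
    (hmin : ∀ r s r' s', P r s → P r' s' → P (min r r') (min s s'))
    (hmax : ∀ r s r' s', P r s → P r' s' → P (min r r') (max s s'))
    (hrow : ∀ r s s' x, P r s → P r s' → s ≤ x → x ≤ s' → P r x)
    (hcol : ∀ r r' s x, P r s → P r' s → r ≤ x → x ≤ r' → P x s)
    {W : Type*} {H : SimpleGraph W} {g : W → Fin (t + 1) × Fin (t + 1)}
    (hg : Function.Injective g) (hgP : ∀ p, P p.1.val p.2.val ↔ ∃ w, g w = p)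
    (hH : ∀ v w, H.Adj v w ↔ (gridGraph t).Adj (g v) (g w)) :
    IsGraphVia (scarfComplex (edgeIdeal k G ^ t)) H
      fun w => gridLabel (e 0) (e 1) (e 2) (e 3) t (g w) := by
  simp only [gridLabel_eq_label]
  have hmem : ∀ w, P (g w).1.val (g w).2.val := fun w => (hgP _).2 ⟨w, rfl⟩
  refine isGraphVia_label k hP ?_ ?_ ?_ ?_
  · intro v w h
    have h2 := congrFun h 2
    have h3 := congrFun h 3
    simp at h2 h3
    exact hg (Prod.ext (Fin.ext h3) (Fin.ext h2))
  · intro y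
    constructor
    · rintro ⟨h1, h2, h3⟩
      obtain ⟨w, hw⟩ := (hgP (⟨y 3, by omega⟩, ⟨y 2, by omega⟩)).1 h3
      refine ⟨w, ?_⟩
      ext i
      fin_cases i <;> simp [hw] <;> omega
    · rintro ⟨w, rfl⟩
      refine ⟨?_, ?_, hmem w⟩ <;> simp <;> omega
  · intro v w hvw
    rw [hH, gridGraph_adj_iff, grid_adj_iff hmin hmax hrow hcol (hmem v) (hmem w)
      (fun h => hvw (hg (Prod.ext (Fin.ext h.1) (Fin.ext h.2))))]
    have hv1 := (g v).1.is_lt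
    have hv2 := (g v).2.is_lt
    have hw1 := (g w).1.is_lt
    have hw2 := (g w).2.is_lt
    constructor
    · intro h u hu
      -- The exponents `t - s` and `s` (likewise `t - r` and `r`) bound the point from both sides,
      -- so dividing the lcm means lying in the box.
      have h0 := hu 0
      have h1 := hu 1
      have h2 := hu 2
      have h3 := hu 3
      simp only [Matrix.cons_val] at h0 h1 h2 h3
      have hu1 := (g u).1.is_lt
      have hu2 := (g u).2.is_lt
      refine (h _ _ (hmem u) (by omega) (by omega) (by omega) (by omega)).imp ?_ ?_ <;>
      · rintro ⟨ha, hb⟩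
        exact hg (Prod.ext (Fin.ext ha) (Fin.ext hb))
    · intro h x y hxy h1 h2 h3 h4
      obtain ⟨u, hu⟩ := (hgP (⟨x, by omega⟩, ⟨y, by omega⟩)).1 hxy
      have := h u fun i => by
        fin_cases i <;> simp [hu] <;> omega
      refine this.imp ?_ ?_ <;>
      · rintro rfl
        simp [hu]
  · intro u v w
    simp only [hH, gridGraph_adj_iff]
    omega

/-- A grid with a unit square does not support a resolution. -/
theorem not_supportsFreeResolution_of_unit_square {k : Type*} [Field k] {V : Type*}
    {I : Ideal (MvPolynomial V k)} {Δ : PreAbstractSimplicialComplex (V →₀ ℕ)} {W : Type*}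
    {H : SimpleGraph W} {ℓ : W → V →₀ ℕ} (h : IsGraphVia Δ H ℓ) {t : ℕ}
    {g : W → Fin (t + 1) × Fin (t + 1)}
    (hH : ∀ v w, H.Adj v w ↔ (gridGraph t).Adj (g v) (g w)) (f : Fin 4 → W) (s : ℕ)
    (h0 : ((g (f 0)).1.val, (g (f 0)).2.val) = (0, s))
    (h1 : ((g (f 1)).1.val, (g (f 1)).2.val) = (0, s + 1))
    (h2 : ((g (f 2)).1.val, (g (f 2)).2.val) = (1, s + 1))
    (h3 : ((g (f 3)).1.val, (g (f 3)).2.val) = (1, s)) :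
    ¬ SupportsFreeResolution Δ I := by
  simp only [Prod.mk.injEq] at h0 h1 h2 h3
  refine not_supportsFreeResolution_of_cycle h (n := 1) f (fun i j hij => ?_) (fun i => ?_)
  · have e1 := congrArg (fun w => (g w).1.val) hij
    have e2 := congrArg (fun w => (g w).2.val) hij
    fin_cases i <;> fin_cases j <;> simp at e1 e2 ⊢ <;> omega
  · rw [hH, gridGraph_adj_iff]
    fin_cases i <;> simp <;> omega

end Grid

/-! ### Exponents of products of `t` edges in the four graphs -/

section Generators

variable {V : Type*} {G : SimpleGraph V}

/-- The vertex `d` has `c` as its only neighbour, whence `x 3 ≤ x 2`. Conversely, split off edges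
`ab` while `a` occurs, then `bc` while `b` occurs, and finally `cd`. -/
theorem nsmul_edgeExponents_path (φ : pathGraph 4 ≃g G) (t : ℕ) :
    t • edgeExponents G =
      label φ.toEquiv '' {x | x 0 + x 2 = t ∧ x 1 + x 3 = t ∧ x 3 ≤ x 2} := by
  refine nsmul_edgeExponents_eq φ (fun t x => x 0 + x 2 = t ∧ x 1 + x 3 = t ∧ x 3 ≤ x 2)
    (fun x => ?_) (fun t y => ?_) t
  · simp only [Fin.forall_fin_succ]
    simp
    omega
  · constructor
    · rintro ⟨h1, h2, h3⟩
      by_cases ha : 1 ≤ y 0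
      · exact ⟨0, 1, by simp [pathGraph_adj], by omega, by omega, by simp; omega⟩
      by_cases hb : 1 ≤ y 1
      · exact ⟨1, 2, by simp [pathGraph_adj], by omega, by omega, by simp; omega⟩
      · exact ⟨2, 3, by simp [pathGraph_adj], by omega, by omega, by simp; omega⟩
    · rintro ⟨i, j, hij, hi, hj, hP⟩
      revert hij hi hj hP
      fin_cases i <;> fin_cases j <;> simp [pathGraph_adj] <;> omega

/-- The square is complete bipartite with sides `{0, 2}` and `{1, 3}`, so the two sides can be
matched arbitrarily. -/
theorem nsmul_edgeExponents_square (φ : cycleGraph 4 ≃g G) (t : ℕ) :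
    t • edgeExponents G =
      label φ.toEquiv '' {x | x 0 + x 2 = t ∧ x 1 + x 3 = t ∧ True} := by
  refine nsmul_edgeExponents_eq φ (fun t x => x 0 + x 2 = t ∧ x 1 + x 3 = t ∧ True)
    (fun x => ?_) (fun t y => ?_) t
  · simp only [Fin.forall_fin_succ]
    simp
    omega
  · constructor
    · rintro ⟨h1, h2, h3⟩
      by_cases ha : 1 ≤ y 0 <;> by_cases hb : 1 ≤ y 1
      · exact ⟨0, 1, by decide, by omega, by omega, by simp; omega⟩
      · exact ⟨0, 3, by decide, by omega, by omega, by simp; omega⟩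
      · exact ⟨1, 2, by decide, by omega, by omega, by simp; omega⟩
      · exact ⟨2, 3, by decide, by omega, by omega, by simp; omega⟩
    · rintro ⟨i, j, hij, hi, hj, hP⟩
      have hij' : (i.val + j.val) % 2 = 1 := by
        clear hi hj hP
        revert i j
        decide
      revert hij' hi hj hP
      clear hij
      fin_cases i <;> fin_cases j <;> simp <;> omega

theorem nsmul_edgeExponents_triangle (φ : (⊤ : SimpleGraph (Fin 3)) ≃g G) (t : ℕ) :
    t • edgeExponents G =
      label φ.toEquiv '' {x | x 0 + x 1 + x 2 = 2 * t ∧ ∀ i, x i ≤ t} := by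
  refine nsmul_edgeExponents_eq φ (fun t x => x 0 + x 1 + x 2 = 2 * t ∧ ∀ i, x i ≤ t)
    (fun x => ?_) (fun t y => ?_) t
  · simp only [Fin.forall_fin_succ]
    simp
    omega
  · simp only [Fin.forall_fin_succ]
    simp only [Fin.succ_zero_eq_one, Fin.succ_one_eq_two, IsEmpty.forall_iff, and_true]
    constructor
    · rintro ⟨h1, h2, h3, h4⟩
      -- Removing an edge leaves the opposite exponent unchanged, so that exponent must already be
      -- at most `t`. If two exponents equal `t + 1`, the third is 0.
      by_cases ha : y 0 ≤ t
      · exact ⟨1, 2, by decide, by omega, by omega, by simp; omega⟩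
      by_cases hb : y 1 ≤ t
      · exact ⟨0, 2, by decide, by omega, by omega, by simp; omega⟩
      · exact ⟨0, 1, by decide, by omega, by omega, by simp; omega⟩
    · rintro ⟨i, j, hij, hi, hj, hP⟩
      revert hij hi hj hP
      fin_cases i <;> fin_cases j <;> simp <;> omega

theorem nsmul_edgeExponents_claw (φ : completeBipartiteGraph (Fin 1) (Fin 3) ≃g G) (t : ℕ) :
    t • edgeExponents G = label φ.toEquiv ''
      {x | x (.inl 0) = t ∧ x (.inr 0) + x (.inr 1) + x (.inr 2) = t} := by
  refine nsmul_edgeExponents_eq φ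
    (fun t x => x (.inl 0) = t ∧ x (.inr 0) + x (.inr 1) + x (.inr 2) = t)
    (fun x => ?_) (fun t y => ?_) t
  · simp only [Sum.forall, Fin.forall_fin_succ]
    simp
    omega
  · constructor
    · rintro ⟨h1, h2⟩
      by_cases ha : 1 ≤ y (.inr 0)
      · exact ⟨.inl 0, .inr 0, by simp, by omega, by omega, by simp; omega⟩
      by_cases hb : 1 ≤ y (.inr 1)
      · exact ⟨.inl 0, .inr 1, by simp, by omega, by omega, by simp; omega⟩
      · exact ⟨.inl 0, .inr 2, by simp, by omega, by omega, by simp; omega⟩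
    · rintro ⟨i | i, j | j, hij, hi, hj, hP⟩ <;> revert hij hi hj hP <;>
        fin_cases i <;> fin_cases j <;> simp <;> omega

end Generators

/-! ### Lattice points of a triangle and its boundary cycle -/

section Triples

/-- The lattice points of the `t`-fold triangle. -/
abbrev Triple (t : ℕ) : Type := {y : Fin 3 → ℕ // y 0 + y 1 + y 2 = t}

/-- Lattice points of a triangle as finitely supported functions with a given sum. -/
noncomputable def tripleEquiv (t : ℕ) :
    Triple t ≃ {y : Fin 3 →₀ ℕ // y ∈ (Finset.univ : Finset (Fin 3)).finsuppAntidiag t} :=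
  Finsupp.equivFunOnFinite.symm.subtypeEquiv fun y => by
    simp [Finset.mem_finsuppAntidiag, Fin.sum_univ_three]

instance (t : ℕ) : Finite (Triple t) := Finite.of_equiv _ (tripleEquiv t).symm

theorem card_triple (t : ℕ) : Nat.card (Triple t) = (t + 2).choose 2 := by
  rw [Nat.card_congr (tripleEquiv t), Nat.card_eq_fintype_card, Fintype.card_coe,
    Finset.card_finsuppAntidiag_nat_eq_choose, Finset.card_univ, Fintype.card_fin,
    show 3 + t - 1 = t + 2 by omega, ← Nat.choose_symm (by omega), Nat.add_sub_cancel_left]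

theorem Triple.ext {t : ℕ} {y z : Triple t} (h0 : y.1 0 = z.1 0) (h1 : y.1 1 = z.1 1) : y = z := by
  have := y.2
  have := z.2
  refine Subtype.ext (funext fun i => ?_)
  fin_cases i <;> simp <;> omega

/-- Two lattice points of a triangle are never the only ones above their minimum. -/
theorem exists_third_ge_min {t a b c a' b' c' : ℕ} (h : a + b + c = t) (h' : a' + b' + c' = t)
    (hne : ¬ (a = a' ∧ b = b')) : ∃ x y z, x + y + z = t ∧
      min a a' ≤ x ∧ min b b' ≤ y ∧ min c c' ≤ z ∧ ¬ (x = a ∧ y = b) ∧ ¬ (x = a' ∧ y = b') := by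
  by_contra! H
  -- Some coordinate of the first point exceeds the minimum. Moving one unit of it to either other
  -- coordinate gives two admissible points, at most one of which is the second point.
  have h1 := H (a + 1) (b - 1) c
  have h2 := H (a - 1) (b + 1) c
  have h3 := H (a + 1) b (c - 1)
  have h4 := H (a - 1) b (c + 1)
  have h5 := H a (b + 1) (c - 1)
  have h6 := H a (b - 1) (c + 1)
  rcases lt_trichotomy a a' with ha | ha | ha <;> rcases lt_trichotomy b b' with hb | hb | hb <;>
    omega

/-- Moving a unit from `b` to `a` stays below the maximum, so it must reach the second point; thus
`c = c'`. If `c` were positive, moving a unit from `c` to `a` would give a third point. -/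
theorem side_adj_of_lt {t a b c a' b' c' : ℕ} (h : a + b + c = t) (h' : a' + b' + c' = t)
    (ha : a < a') (hb : b' < b) (H : ∀ x y z, x + y + z = t → x ≤ max a a' → y ≤ max b b' →
      z ≤ max c c' → (x = a ∧ y = b) ∨ (x = a' ∧ y = b')) :
    c = 0 ∧ c' = 0 ∧ a + 1 = a' := by
  have h1 := H (a + 1) (b - 1) c (by omega) (by omega) (by omega) (by omega)
  rcases Nat.eq_zero_or_pos c with hc | hc
  · omega
  · have := H (a + 1) b (c - 1) (by omega) (by omega) (by omega) (by omega)
    omega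

/-- Two lattice points of a triangle are the only ones below their maximum if and only if they are
consecutive points on one side. -/
theorem side_adj_iff {t a b c a' b' c' : ℕ} (h : a + b + c = t) (h' : a' + b' + c' = t)
    (hne : ¬ (a = a' ∧ b = b')) :
    (c = 0 ∧ c' = 0 ∧ (a + 1 = a' ∨ a' + 1 = a) ∨ a = 0 ∧ a' = 0 ∧ (b + 1 = b' ∨ b' + 1 = b) ∨
      b = 0 ∧ b' = 0 ∧ (c + 1 = c' ∨ c' + 1 = c)) ↔
    ∀ x y z, x + y + z = t → x ≤ max a a' → y ≤ max b b' → z ≤ max c c' →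
      (x = a ∧ y = b) ∨ (x = a' ∧ y = b') := by
  constructor
  · rintro (⟨h1, h2, h3⟩ | ⟨h1, h2, h3⟩ | ⟨h1, h2, h3⟩) x y z _ _ _ _ <;>
      rcases h3 with h3 | h3 <;> omega
  · intro H
    -- The sums agree and the points differ, so one coordinate increases while another decreases:
    -- six ordered pairs of coordinates.
    have hab : a < a' → b' < b → c = 0 ∧ c' = 0 ∧ a + 1 = a' := fun ha hb =>
      side_adj_of_lt h h' ha hb H
    have hba : b < b' → a' < a → c = 0 ∧ c' = 0 ∧ b + 1 = b' := fun ha hb =>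
      side_adj_of_lt (t := t) (by omega) (by omega) ha hb fun x y z _ _ _ _ => by
        have := H y x z (by omega) (by omega) (by omega) (by omega)
        omega
    have hac : a < a' → c' < c → b = 0 ∧ b' = 0 ∧ a + 1 = a' := fun ha hb =>
      side_adj_of_lt (t := t) (by omega) (by omega) ha hb fun x y z _ _ _ _ => by
        have := H x z y (by omega) (by omega) (by omega) (by omega)
        omega
    have hca : c < c' → a' < a → b = 0 ∧ b' = 0 ∧ c + 1 = c' := fun ha hb =>
      side_adj_of_lt (t := t) (by omega) (by omega) ha hb fun x y z _ _ _ _ => by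
        have := H y z x (by omega) (by omega) (by omega) (by omega)
        omega
    have hbc : b < b' → c' < c → a = 0 ∧ a' = 0 ∧ b + 1 = b' := fun ha hb =>
      side_adj_of_lt (t := t) (by omega) (by omega) ha hb fun x y z _ _ _ _ => by
        have := H z x y (by omega) (by omega) (by omega) (by omega)
        omega
    have hcb : c < c' → b' < b → a = 0 ∧ a' = 0 ∧ c + 1 = c' := fun ha hb =>
      side_adj_of_lt (t := t) (by omega) (by omega) ha hb fun x y z _ _ _ _ => by
        have := H z y x (by omega) (by omega) (by omega) (by omega)
        omega
    rcases lt_trichotomy a a' with ha | ha | ha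
    · by_cases hb : b' < b
      · obtain ⟨h1, h2, h3⟩ := hab ha hb
        exact Or.inl ⟨h1, h2, Or.inl h3⟩
      · obtain ⟨h1, h2, h3⟩ := hac ha (by omega)
        exact Or.inr (Or.inr ⟨h1, h2, Or.inr (by omega)⟩)
    · rcases lt_or_gt_of_ne (fun hb => hne ⟨ha, hb⟩ : b ≠ b') with hb | hb
      · obtain ⟨h1, h2, h3⟩ := hbc hb (by omega)
        exact Or.inr (Or.inl ⟨h1, h2, Or.inl h3⟩)
      · obtain ⟨h1, h2, h3⟩ := hcb (by omega) hb
        exact Or.inr (Or.inl ⟨h1, h2, Or.inr (by omega)⟩)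
    · by_cases hb : b < b'
      · obtain ⟨h1, h2, h3⟩ := hba hb ha
        exact Or.inl ⟨h1, h2, Or.inr (by omega)⟩
      · obtain ⟨h1, h2, h3⟩ := hca (by omega) ha
        exact Or.inr (Or.inr ⟨h1, h2, Or.inl h3⟩)

/-- The points on the boundary of a triangle, in cyclic order. -/
def boundary (t s : ℕ) : Fin 3 → ℕ :=
  if s ≤ t then ![t - s, s, 0] else if s ≤ 2 * t then ![0, 2 * t - s, s - t]
  else ![s - 2 * t, 0, 3 * t - s]

theorem boundary_sum {t s : ℕ} (hs : s < 3 * t) :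
    boundary t s 0 + boundary t s 1 + boundary t s 2 = t := by
  unfold boundary
  split_ifs <;> simp <;> omega

theorem boundary_injective {t s s' : ℕ} (hs : s < 3 * t) (hs' : s' < 3 * t)
    (h0 : boundary t s 0 = boundary t s' 0) (h1 : boundary t s 1 = boundary t s' 1) : s = s' := by
  revert h0 h1
  unfold boundary
  split_ifs <;> simp <;> omega

theorem exists_boundary_eq {t a b c : ℕ} (ht : 1 ≤ t) (h : a + b + c = t)
    (h0 : a = 0 ∨ b = 0 ∨ c = 0) : ∃ s < 3 * t, boundary t s 0 = a ∧ boundary t s 1 = b := by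
  by_cases hc : c = 0
  · refine ⟨b, by omega, ?_⟩
    rw [boundary, if_pos (by omega)]
    simp
    omega
  by_cases ha : a = 0
  · refine ⟨t + c, by omega, ?_⟩
    rw [boundary, if_neg (by omega), if_pos (by omega)]
    simp
    omega
  · refine ⟨2 * t + a, by omega, ?_⟩
    rw [boundary, if_neg (by omega), if_neg (by omega)]
    simp
    omega

theorem boundary_adj_iff {t s s' : ℕ} (ht : 2 ≤ t) (hs : s < 3 * t) (hs' : s' < 3 * t) :
    (boundary t s 2 = 0 ∧ boundary t s' 2 = 0 ∧
        (boundary t s 0 + 1 = boundary t s' 0 ∨ boundary t s' 0 + 1 = boundary t s 0) ∨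
      boundary t s 0 = 0 ∧ boundary t s' 0 = 0 ∧
        (boundary t s 1 + 1 = boundary t s' 1 ∨ boundary t s' 1 + 1 = boundary t s 1) ∨
      boundary t s 1 = 0 ∧ boundary t s' 1 = 0 ∧
        (boundary t s 2 + 1 = boundary t s' 2 ∨ boundary t s' 2 + 1 = boundary t s 2)) ↔
    s + 1 = s' ∨ s' + 1 = s ∨ s = 0 ∧ s' + 1 = 3 * t ∨ s' = 0 ∧ s + 1 = 3 * t := by
  unfold boundary
  split_ifs <;> simp <;> omega

theorem cycleGraph_adj_iff_val {n : ℕ} (hn : 2 ≤ n) {u v : Fin n} : (cycleGraph n).Adj u v ↔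
    u.val + 1 = v.val ∨ v.val + 1 = u.val ∨ u.val = 0 ∧ v.val + 1 = n ∨
      v.val = 0 ∧ u.val + 1 = n := by
  rw [cycleGraph_adj']
  have hu := u.is_lt
  have hv := v.is_lt
  have h : ∀ x y : Fin n, (x - y).val = if y ≤ x then x.val - y.val else n + x.val - y.val :=
    fun x y => by
      split_ifs with hxy
      · exact Fin.coe_sub_iff_le.2 hxy
      · exact Fin.coe_sub_iff_lt.2 (not_le.1 hxy)
  simp only [h, Fin.le_def]
  split_ifs <;> omega

end Triples

/-! ### The Scarf complexes of the four families -/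

section Cases

variable (k : Type*) [Field k] {V : Type*} {G : SimpleGraph V} {t : ℕ}

/-- The coordinate `(E w).1 i` is the multiplicity of the edge opposite to `i`. A larger exponent
means a smaller multiplicity, so the divisors of an lcm are the points above a minimum, and there is
always a third one. -/
theorem isGraphVia_scarfComplex_triangle (φ : (⊤ : SimpleGraph (Fin 3)) ≃g G) {W : Type*}
    (E : W ≃ Triple t) : IsGraphVia (scarfComplex (edgeIdeal k G ^ t)) (⊥ : SimpleGraph W)
      fun w => label φ.toEquiv fun i => t - (E w).1 i := by
  refine isGraphVia_label k (nsmul_edgeExponents_triangle φ t) (fun v w h => ?_) (fun y => ?_)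
    (fun v w hvw => ?_) (by simp)
  · have hv := (E v).2
    have hw := (E w).2
    have h0 : t - (E v).1 0 = t - (E w).1 0 := congrFun h 0
    have h1 : t - (E v).1 1 = t - (E w).1 1 := congrFun h 1
    exact E.injective (Triple.ext (by omega) (by omega))
  · constructor
    · rintro ⟨h1, h2⟩
      have h20 := h2 0
      have h21 := h2 1
      have h22 := h2 2
      refine ⟨E.symm ⟨fun i => t - y i, by beta_reduce; omega⟩, funext fun i => ?_⟩
      have := h2 i
      simp
      omega
    · rintro ⟨w, rfl⟩
      have hw := (E w).2
      exact ⟨by beta_reduce; omega, fun i => Nat.sub_le _ _⟩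
  · have hv := (E v).2
    have hw := (E w).2
    obtain ⟨x, y, z, hs, h0, h1, h2, hnv, hnw⟩ := exists_third_ge_min hv hw
      fun h => hvw (E.injective (Triple.ext h.1 h.2))
    simp only [bot_adj, false_iff]
    intro H
    rcases H (E.symm ⟨![x, y, z], by simpa using hs⟩) fun i => by
      fin_cases i <;> simp <;> omega with rfl | rfl
    · simp at hnv
    · simp at hnw

theorem isGraphVia_scarfComplex_path (φ : pathGraph 4 ≃g G) :
    IsGraphVia (scarfComplex (edgeIdeal k G ^ t)) (upperGridGraph t)
      (fun p => gridLabel (φ 0) (φ 1) (φ 2) (φ 3) t p.1) :=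
  isGraphVia_induce_gridGraph k (P := fun r s => r ≤ s) (nsmul_edgeExponents_path φ t)
    (fun _ _ _ _ _ _ => by omega) (fun _ _ _ _ _ _ => by omega)
    (fun _ _ _ _ _ _ _ _ => by omega) (fun _ _ _ _ _ _ _ _ => by omega)
    Subtype.val_injective (fun p => ⟨fun h => ⟨⟨p, h⟩, rfl⟩, fun ⟨w, hw⟩ => hw ▸ w.2⟩)
    fun _ _ => Iff.rfl

theorem isGraphVia_scarfComplex_square (φ : cycleGraph 4 ≃g G) :
    IsGraphVia (scarfComplex (edgeIdeal k G ^ t)) (gridGraph t)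
      (gridLabel (φ 0) (φ 1) (φ 2) (φ 3) t) :=
  isGraphVia_induce_gridGraph k (P := fun _ _ => True) (nsmul_edgeExponents_square φ t)
    (fun _ _ _ _ _ _ => trivial) (fun _ _ _ _ _ _ => trivial)
    (fun _ _ _ _ _ _ _ _ => trivial) (fun _ _ _ _ _ _ _ _ => trivial)
    Function.injective_id (fun p => ⟨fun _ => ⟨p, rfl⟩, fun _ => trivial⟩)
    fun _ _ => Iff.rfl

/-- The boundary points, as lattice points of the triangle. -/
def boundaryTriple (t : ℕ) (s : Fin (3 * t)) : Triple t := ⟨boundary t s, boundary_sum s.is_lt⟩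

theorem boundaryTriple_injective (t : ℕ) : Function.Injective (boundaryTriple t) := fun s s' h =>
  Fin.ext (boundary_injective s.is_lt s'.is_lt (congrFun (congrArg Subtype.val h) 0)
    (congrFun (congrArg Subtype.val h) 1))

/-- The inequality, from injectivity of the boundary walk, shows that the subtraction is not
truncated. -/
theorem card_compl_range_boundaryTriple (t : ℕ) :
    3 * t ≤ (t + 2).choose 2 ∧
      Nat.card ↥(Set.range (boundaryTriple t))ᶜ = (t + 2).choose 2 - 3 * t := by
  have h := Set.ncard_add_ncard_compl (Set.range (boundaryTriple t))
  rw [card_triple, ← Set.image_univ, Set.ncard_image_of_injective _ (boundaryTriple_injective t),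
    Set.ncard_univ, Nat.card_eq_fintype_card, Fintype.card_fin, Set.image_univ] at h
  rw [Nat.card_coe_set_eq]
  omega

theorem exists_equiv_triple (t : ℕ) :
    ∃ E : Fin (3 * t) ⊕ Fin ((t + 2).choose 2 - 3 * t) ≃ Triple t,
      ∀ s, E (.inl s) = boundaryTriple t s := by
  classical
  exact ⟨((Equiv.ofInjective _ (boundaryTriple_injective t)).sumCongr
    (Finite.equivFinOfCardEq (card_compl_range_boundaryTriple t).2).symm).trans
    (Equiv.Set.sumCompl _), fun s => rfl⟩

theorem label_boundary (φ : Fin 1 ⊕ Fin 3 ≃ V) {t s : ℕ} :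
    label φ (Sum.elim (fun _ => t) (boundary t s)) =
      clawCycleLabel (φ (.inl 0)) (φ (.inr 0)) (φ (.inr 1)) (φ (.inr 2)) t s := by
  refine ((eq_label_iff _ _ _).2 ?_).symm
  unfold clawCycleLabel boundary
  rintro (i | i)
  · fin_cases i
    split_ifs <;> simp
  · split_ifs <;> fin_cases i <;> simp

theorem isGraphVia_scarfComplex_claw (ht : 2 ≤ t)
    (φ : completeBipartiteGraph (Fin 1) (Fin 3) ≃g G) {N : ℕ}
    (E : Fin (3 * t) ⊕ Fin N ≃ Triple t) (hE : ∀ s, E (.inl s) = boundaryTriple t s) :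
    IsGraphVia (scarfComplex (edgeIdeal k G ^ t)) (SimpleGraph.sum (cycleGraph (3 * t)) ⊥)
      fun w => label φ.toEquiv (Sum.elim (fun _ => t) (E w).1) := by
  -- The points off the cycle are interior, while adjacency requires a common vanishing coordinate;
  -- hence they are isolated.
  have hinr : ∀ w, 0 < (E (.inr w)).1 0 ∧ 0 < (E (.inr w)).1 1 ∧ 0 < (E (.inr w)).1 2 := by
    intro w
    have hw := (E (.inr w)).2
    by_contra h
    obtain ⟨s, hs, h0, h1⟩ := exists_boundary_eq (by omega) hw (by omega)
    have := hE ⟨s, hs⟩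
    have := E.injective ((hE ⟨s, hs⟩).trans (Triple.ext h0 h1))
    simp at this
  refine isGraphVia_label k (nsmul_edgeExponents_claw φ t) (fun v w h => ?_) (fun y => ?_)
    (fun v w hvw => ?_) ?_
  · exact E.injective (Triple.ext (congrFun h (.inr 0)) (congrFun h (.inr 1)))
  · constructor
    · rintro ⟨h1, h2⟩
      refine ⟨E.symm ⟨fun i => y (.inr i), h2⟩, funext ?_⟩
      rintro (i | i)
      · rw [Subsingleton.elim i 0]
        simp [h1]
      · simp
    · rintro ⟨w, rfl⟩
      exact ⟨rfl, (E w).2⟩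
  · have key := side_adj_iff (E v).2 (E w).2
      fun h => hvw (E.injective (Triple.ext h.1 h.2))
    refine Iff.trans (Iff.trans ?_ key) ?_
    · rcases v with v | v <;> rcases w with w | w
      · rw [hE, hE]
        exact (cycleGraph_adj_iff_val (by omega)).trans
          (boundary_adj_iff ht v.is_lt w.is_lt).symm
      · have := hinr w
        simp
        omega
      · have := hinr v
        simp
        omega
      · have := hinr w
        simp
        omega
    · constructor
      · intro H u hu
        refine (H _ _ _ (E u).2 (hu (.inr 0)) (hu (.inr 1)) (hu (.inr 2))).imp ?_ ?_ <;>
        · rintro ⟨h0, h1⟩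
          exact E.injective (Triple.ext h0 h1)
      · intro H x y z hs hx hy hz
        refine (H (E.symm ⟨![x, y, z], by simpa using hs⟩) ?_).imp ?_ ?_
        · rintro (i | i)
          · simp
          · fin_cases i <;> simp <;> omega
        all_goals
          rintro rfl
          simp
  -- The cycle has length `3 * t ≥ 6` and so contains no triangle; for `t = 1` it would be one.
  · rintro (u | u) (v | v) (w | w) <;>
      simp [cycleGraph_adj_iff_val (show 2 ≤ 3 * t by omega)] <;> omega

end Cases

theorem theoremt (k : Type*) [Field k] {V : Type*} (G : SimpleGraph V) (t : ℕ) :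
    -- triangles
    (1 ≤ t → Nonempty ((⊤ : SimpleGraph (Fin 3)) ≃g G) →
      (∃ ℓ : Fin ((t + 2).choose 2) → (V →₀ ℕ),
        IsGraphVia (scarfComplex (edgeIdeal k G ^ t)) ⊥ ℓ) ∧
      ¬ HasScarfResolution (edgeIdeal k G ^ t)) ∧
    -- paths of length 3, with edges `ab`, `bc`, `cd`
    (2 ≤ t → ∀ φ : SimpleGraph.pathGraph 4 ≃g G,
      IsGraphVia (scarfComplex (edgeIdeal k G ^ t)) (upperGridGraph t)
        (fun p => gridLabel (φ 0) (φ 1) (φ 2) (φ 3) t p.1) ∧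
      ¬ HasScarfResolution (edgeIdeal k G ^ t)) ∧
    -- claws, with edges `ab`, `ac`, `ad`
    (2 ≤ t → ∀ φ : completeBipartiteGraph (Fin 1) (Fin 3) ≃g G,
      (∃ ℓ : Fin (3 * t) ⊕ Fin ((t + 2).choose 2 - 3 * t) → (V →₀ ℕ),
        IsGraphVia (scarfComplex (edgeIdeal k G ^ t))
          (SimpleGraph.sum (SimpleGraph.cycleGraph (3 * t)) ⊥) ℓ ∧
        ∀ s : Fin (3 * t), ℓ (Sum.inl s) =
          clawCycleLabel (φ (Sum.inl 0)) (φ (Sum.inr 0)) (φ (Sum.inr 1)) (φ (Sum.inr 2)) t s) ∧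
      3 * t ≤ (t + 2).choose 2 ∧
      ¬ HasScarfResolution (edgeIdeal k G ^ t)) ∧
    -- squares, with edges `ab`, `bc`, `cd`, `da`
    (1 ≤ t → ∀ φ : SimpleGraph.cycleGraph 4 ≃g G,
      IsGraphVia (scarfComplex (edgeIdeal k G ^ t)) (gridGraph t)
        (gridLabel (φ 0) (φ 1) (φ 2) (φ 3) t) ∧
      ¬ HasScarfResolution (edgeIdeal k G ^ t)) := by
  refine ⟨?_, ?_, ?_, ?_⟩
  · rintro ht ⟨φ⟩
    have h := isGraphVia_scarfComplex_triangle k φ (Finite.equivFinOfCardEq (card_triple t)).symm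
    have : Fact (1 < (t + 2).choose 2) :=
      ⟨lt_of_lt_of_le (by decide : 1 < (1 + 2).choose 2) (Nat.choose_le_choose 2 (by omega))⟩
    have : Nontrivial (Fin ((t + 2).choose 2)) := Fin.nontrivial_iff_two_le.2 this.out
    exact ⟨⟨_, h⟩, not_supportsFreeResolution_of_isGraphVia_bot h⟩
  · intro ht φ
    have h := isGraphVia_scarfComplex_path k (t := t) φ
    refine ⟨h, not_supportsFreeResolution_of_unit_square h (fun _ _ => Iff.rfl)
      -- The square in rows 0, 1 and columns 1, 2: the one in columns 0, 1 has its corner `(1, 0)`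
      -- below the diagonal. Column 2 exists because `2 ≤ t`.
      ![⟨(⟨0, by omega⟩, ⟨1, by omega⟩), by simp⟩, ⟨(⟨0, by omega⟩, ⟨2, by omega⟩), by simp⟩,
        ⟨(⟨1, by omega⟩, ⟨2, by omega⟩), by simp⟩, ⟨(⟨1, by omega⟩, ⟨1, by omega⟩), by simp⟩]
      1 rfl rfl rfl rfl⟩
  · intro ht φ
    obtain ⟨E, hE⟩ := exists_equiv_triple t
    have h := isGraphVia_scarfComplex_claw k ht φ E hE
    refine ⟨⟨_, h, fun s => ?_⟩, (card_compl_range_boundaryTriple t).1, ?_⟩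
    · rw [hE]
      exact label_boundary φ.toEquiv
    · obtain ⟨n, hn⟩ : ∃ n, 3 * t = n + 3 := ⟨3 * t - 3, by omega⟩
      refine not_supportsFreeResolution_of_cycle h (n := n) (fun i => .inl (Fin.cast hn.symm i))
        (fun i j hij => by simpa using hij) fun i => ?_
      rw [sum_adj_inl, cycleGraph_adj_iff_val (by omega)]
      simp only [Fin.val_cast, Fin.val_add_one]
      split_ifs with hi
      · simp [hi]
        omega
      · exact Or.inl rfl
  · intro ht φ
    have h := isGraphVia_scarfComplex_square k (t := t) φ
    exact ⟨h, not_supportsFreeResolution_of_unit_square h (g := id) (fun _ _ => Iff.rfl)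
      ![(⟨0, by omega⟩, ⟨0, by omega⟩), (⟨0, by omega⟩, ⟨1, by omega⟩),
        (⟨1, by omega⟩, ⟨1, by omega⟩), (⟨1, by omega⟩, ⟨0, by omega⟩)] 0 rfl rfl rfl rfl⟩
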